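/- Let $\mathcal H$ be a separable complex Hilbert space and let $T_i\in B(\mathcal H)$, $i=1,\dots,n$ ($n\in\{1,2,\dots\}$ or $n=\infty$), be such that $$\varphi_T(X):=\sum_{i=1}^n T_iXT_i^*,\qquad X\in B(\mathcal H),$$ defines a $w^*$-continuous completely positive map (the series converging in the $w^*$-topology if $n=\infty$) with $\varphi_T(I)\le I$. Let $[V_1,V_2,\dots]$ be the minimal isometric dilation of $[T_1,T_2,\dots]$ on a Hilbert space $\mathcal K\supseteq\mathcal H$: the $V_i\in B(\mathcal K)$ are isometries with $V_i^*V_j=0$ for $i\ne j$, $V_i^*|_{\mathcal H}=T_i^*$, and $\mathcal K$ is the closed linear span of the spaces $V_{i_1}\cdots V_{i_k}\mathcal H$, $k\ge 0$. Put $\varphi_V(Y):=\sum_i V_iYV_i^*$, $Y\in B(\mathcal K)$, and let $P_{\mathcal H}$ be the orthogonal projection of $\mathcal K$ onto $\mathcal H$. Let $S_i$, $S_if=e_i\otimes f$, be the left creation operators on the full Fock space $F^2(H_n)=\bigoplus_{k\ge0}H_n^{\otimes k}$ of an $n$-dimensional Hilbert space $H_n$ with orthonormal basis $(e_i)$. For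 every $B\in B(\mathcal K)$ in the commutant of $\{V_i,V_i^*\}_i$ the limit $\text{SOT-}\lim_{k\to\infty}\varphi_V^k(B)$ exists. A positive operator $A\in B(\mathcal H)$ is a solution of $\varphi_T(X)\le X$ if and only if there exist (i) an operator $B\in B(\mathcal K)$ in the commutant of $\{V_i,V_i^*\}_i$, and (ii) a Hilbert space $\mathcal D$ and a bounded operator $K:\mathcal K\to F^2(H_n)\otimes\mathcal D$ with $V_iK^*=K^*(S_i\otimes I_{\mathcal D})$ for all $i$, such that $$A=P_{\mathcal H}A_1|_{\mathcal H}+P_{\mathcal H}A_2|_{\mathcal H},\qquad \|A\|=\|A_1+A_2\|,\qquad(*)$$ where $A_1:=\text{SOT-}\lim_{k\to\infty}\varphi_V^k(B)$ and $A_2:=K^*K$. Moreover, for every positive $A\in B(\mathcal H)$ and all $B$, $\mathcal D$, $K$ as in (i) and (ii) that satisfy $(*)$, the decomposition in $(*)$ is the canonical decomposition of $A$ with respect to $\varphi_T$: the pair $(A',A'')=(P_{\mathcal H}A_1|_{\mathcal H},\,P_{\mathcal H}A_2|_{\mathcal H})$ is the unique pair of operators in $B(\mathcal H)$ such that $A=A'+A''$,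 $A'=A'^*$, $\varphi_T(A')=A'$, $A''\ge0$, $\varphi_T(A'')\le A''$ and $\text{SOT-}\lim_{k\to\infty}\varphi_T^k(A'')=0$. -/

import Mathlib

open Filter Topology ContinuousLinearMap

universe u v w x

noncomputable section

namespace CPMap

/-! ### The full Fock space with multiplicity space -/

/-- The Hilbert space `F²(Hₙ) ⊗ D`, where `Hₙ` has an orthonormal basis `(eᵢ)` indexed by `ι`.
The full Fock space `F²(Hₙ) = ⨁ₖ Hₙ^{⊗k}` has the orthonormal basis `e_α`, `α` a word of the free
semigroup `FreeMonoid ι`, so that `F²(Hₙ) ⊗ D` is the space of all square-summable families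
`(d_α)` in `D`, the family `(d_α)` being the vector `∑ e_α ⊗ d_α`. -/
abbrev Fock (ι : Type u) (D : Type v) [NormedAddCommGroup D] : Type (max u v) :=
  lp (fun _ : FreeMonoid ι => D) 2

section Creation

variable {ι : Type u} {D : Type v} [NormedAddCommGroup D]

lemma of_mul_injective (i : ι) :
    Function.Injective (fun α : FreeMonoid ι => FreeMonoid.of i * α) := by
  intro a b h
  exact mul_left_cancel h

/-- The coordinates of `(Sᵢ ⊗ I) f`: the one at the word `gᵢ α` is `f α`, all others are `0`. -/
def creationFun (i : ι) (f : FreeMonoid ι → D) : FreeMonoid ι → D :=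
  Function.extend (fun α => FreeMonoid.of i * α) f 0

lemma norm_rpow_creationFun (i : ι) (f : FreeMonoid ι → D) :
    (fun w => ‖creationFun i f w‖ ^ (2 : ENNReal).toReal) =
      Function.extend (fun α => FreeMonoid.of i * α)
        (fun α => ‖f α‖ ^ (2 : ENNReal).toReal) 0 := by
  funext w
  by_cases h : ∃ α, FreeMonoid.of i * α = w
  · obtain ⟨α, rfl⟩ := h
    simp only [creationFun]
    rw [(of_mul_injective i).extend_apply, (of_mul_injective i).extend_apply]
  · simp only [creationFun]
    rw [Function.extend_apply' _ _ _ h, Function.extend_apply' _ _ _ h]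
    simp

lemma creationFun_add (i : ι) (f g : FreeMonoid ι → D) :
    creationFun i (f + g) = creationFun i f + creationFun i g := by
  funext w
  by_cases h : ∃ α, FreeMonoid.of i * α = w
  · obtain ⟨α, rfl⟩ := h
    simp only [creationFun, Pi.add_apply]
    rw [(of_mul_injective i).extend_apply, (of_mul_injective i).extend_apply,
      (of_mul_injective i).extend_apply, Pi.add_apply]
  · simp only [creationFun, Pi.add_apply]
    rw [Function.extend_apply' _ _ _ h, Function.extend_apply' _ _ _ h,
      Function.extend_apply' _ _ _ h]
    simp

lemma creationFun_smul [InnerProductSpace ℂ D] (i : ι) (c : ℂ) (f : FreeMonoid ι → D) :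
    creationFun i (c • f) = c • creationFun i f := by
  funext w
  by_cases h : ∃ α, FreeMonoid.of i * α = w
  · obtain ⟨α, rfl⟩ := h
    simp only [creationFun, Pi.smul_apply]
    rw [(of_mul_injective i).extend_apply, (of_mul_injective i).extend_apply, Pi.smul_apply]
  · simp only [creationFun, Pi.smul_apply]
    rw [Function.extend_apply' _ _ _ h, Function.extend_apply' _ _ _ h]
    simp

lemma memℓp_creationFun (i : ι) (f : Fock ι D) :
    Memℓp (creationFun i (f : FreeMonoid ι → D)) 2 := by
  apply memℓp_gen
  rw [norm_rpow_creationFun, summable_extend_zero (of_mul_injective i)]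
  exact (lp.memℓp f).summable (by norm_num)

/-- The operator `Sᵢ ⊗ I_D` on `F²(Hₙ) ⊗ D`, where `Sᵢ` is the `i`-th left creation operator
`f ↦ eᵢ ⊗ f`. It is an isometry. -/
def creation (D : Type v) [NormedAddCommGroup D] [InnerProductSpace ℂ D] (i : ι) :
    Fock ι D →ₗᵢ[ℂ] Fock ι D where
  toFun f := ⟨creationFun i f, memℓp_creationFun i f⟩
  map_add' f g := by
    ext w
    exact congrFun (creationFun_add i f g) w
  map_smul' c f := by
    ext w
    exact congrFun (creationFun_smul i c f) w
  norm_map' f := by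
    have h2 : (0 : ℝ) < (2 : ENNReal).toReal := by norm_num
    rw [lp.norm_eq_tsum_rpow h2, lp.norm_eq_tsum_rpow h2]
    congr 1
    change ∑' w, ‖creationFun i f w‖ ^ (2 : ENNReal).toReal = _
    rw [norm_rpow_creationFun, tsum_extend_zero (of_mul_injective i)]

/-- `(Sᵢ ⊗ I)(e_α ⊗ d) = e_{gᵢ α} ⊗ d`. -/
lemma creation_single [InnerProductSpace ℂ D] [DecidableEq (FreeMonoid ι)] (i : ι) (α : FreeMonoid ι) (d : D) :
    creation D i (lp.single 2 α d) = lp.single 2 (FreeMonoid.of i * α) d := by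
  ext w
  change creationFun i (Pi.single α d) w =
    (Pi.single (FreeMonoid.of i * α) d : FreeMonoid ι → D) w
  unfold creationFun
  by_cases h : ∃ β, FreeMonoid.of i * β = w
  · obtain ⟨β, rfl⟩ := h
    rw [(of_mul_injective i).extend_apply (Pi.single α d) 0 β]
    simp [Pi.single_apply]
  · rw [Function.extend_apply' _ _ _ h, Pi.single_eq_of_ne]
    · rfl
    · rintro rfl
      exact h ⟨α, rfl⟩

end Creation

/-! ### Completely positive maps and their canonical decompositions -/

section Maps

variable {ι : Type u} {H : Type v} [NormedAddCommGroup H] [InnerProductSpace ℂ H] [CompleteSpace H]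

/-- For every bounded `X` the series `∑ᵢ Tᵢ X Tᵢ*` converges, i.e. `X ↦ ∑ᵢ Tᵢ X Tᵢ*` is defined on
all of `B(H)`. Convergence is in the weak operator topology; convergence for `X = I` bounds all
partial sums, and on bounded sets this topology is the w*-topology. -/
def KrausSummable (T : ι → H →L[ℂ] H) : Prop :=
  ∀ X : H →L[ℂ] H, Summable fun i => ContinuousLinearMapWOT.ofCLM (T i * X * adjoint (T i))

/-- The completely positive map `φ_T(X) = ∑ᵢ Tᵢ X Tᵢ*`. -/
def krausMap (T : ι → H →L[ℂ] H) (X : H →L[ℂ] H) : H →L[ℂ] H :=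
  ContinuousLinearMapWOT.toCLM
    (∑' i, ContinuousLinearMapWOT.ofCLM (T i * X * adjoint (T i)))

/-- `A = SOT-lim Xₖ`. -/
def IsSOTLimit (X : ℕ → H →L[ℂ] H) (A : H →L[ℂ] H) : Prop :=
  ∀ h : H, Tendsto (fun k => X k h) atTop (𝓝 (A h))

/-- `C` is a pure solution of `φ(X) ≤ X`: it is a solution and `φᵏ(C) → 0` strongly. -/
def IsPureSolution (φ : (H →L[ℂ] H) → (H →L[ℂ] H)) (C : H →L[ℂ] H) : Prop :=
  φ C ≤ C ∧ IsSOTLimit (fun k => φ^[k] C) 0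

/-- `A = B + C` is a canonical decomposition of `A` with respect to `φ`: `B` is a selfadjoint
solution of `φ(X) = X`, and `C ≥ 0` is a pure solution of `φ(X) ≤ X`. -/
structure IsCanonicalDecomposition (φ : (H →L[ℂ] H) → (H →L[ℂ] H)) (A B C : H →L[ℂ] H) :
    Prop where
  selfAdjoint : IsSelfAdjoint B
  fixed : φ B = B
  nonneg : 0 ≤ C
  pure : IsPureSolution φ C
  sum_eq : A = B + C

end Maps

/-! ### Minimal isometric dilations -/

section Dilation

variable {ι : Type u} {H : Type v} [NormedAddCommGroup H] [InnerProductSpace ℂ H] [CompleteSpace H]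
  {𝒦 : Type w} [NormedAddCommGroup 𝒦] [InnerProductSpace ℂ 𝒦] [CompleteSpace 𝒦]

/-- The compression `P_H Y|_H` of `Y ∈ B(𝒦)` to `H`, where `H` sits in `𝒦` through `J`. -/
def compression (J : H →ₗᵢ[ℂ] 𝒦) (Y : 𝒦 →L[ℂ] 𝒦) : H →L[ℂ] H :=
  adjoint J.toContinuousLinearMap ∘L Y ∘L J.toContinuousLinearMap

/-- `[V₁, V₂, …]` on `𝒦 ⊇ H` is the minimal isometric dilation of `[T₁, T₂, …]`: the `Vᵢ` are
isometries with orthogonal ranges, `Vᵢ*|_H = Tᵢ*`, and `𝒦` is the closed span of all `V_α H`. The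
inclusion of `H` in `𝒦` is the isometry `J`, and `V_α = V_{i₁} ⋯ V_{iₖ}` for `α = g_{i₁} ⋯ g_{iₖ}`. -/
structure IsMinimalIsometricDilation (T : ι → H →L[ℂ] H) (J : H →ₗᵢ[ℂ] 𝒦)
    (V : ι → 𝒦 →L[ℂ] 𝒦) : Prop where
  isometry : ∀ i, adjoint (V i) * V i = 1
  orthogonal : ∀ i j, i ≠ j → adjoint (V i) * V j = 0
  adjoint_apply : ∀ i (h : H), adjoint (V i) (J h) = J (adjoint (T i) h)
  minimal : (Submodule.span ℂ
    {x : 𝒦 | ∃ (α : FreeMonoid ι) (h : H), x = FreeMonoid.lift V α (J h)}).topologicalClosure = ⊤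

/-- `B` is in the commutant of `{Vᵢ, Vᵢ*}`. -/
def InCommutant (V : ι → 𝒦 →L[ℂ] 𝒦) (B : 𝒦 →L[ℂ] 𝒦) : Prop :=
  B ∈ Set.centralizer (Set.range V ∪ Set.range fun i => adjoint (V i))

/-- The data `B`, `Q : 𝒦 → F²(Hₙ) ⊗ D` represent `A`: `B` is in the commutant of `{Vᵢ, Vᵢ*}`,
`A₁ = SOT-lim φ_Vᵏ(B)`, `Vᵢ Q* = Q* (Sᵢ ⊗ I_D)`, `A₂ = Q* Q`,
`A = P_H A₁|_H + P_H A₂|_H`, and `‖A‖ = ‖A₁ + A₂‖`. -/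
structure Represents {D : Type*} [NormedAddCommGroup D] [InnerProductSpace ℂ D] [CompleteSpace D]
    (J : H →ₗᵢ[ℂ] 𝒦) (V : ι → 𝒦 →L[ℂ] 𝒦) (A : H →L[ℂ] H)
    (B : 𝒦 →L[ℂ] 𝒦) (Q : 𝒦 →L[ℂ] Fock ι D) (A₁ A₂ : 𝒦 →L[ℂ] 𝒦) : Prop where
  commutant : InCommutant V B
  limit : IsSOTLimit (fun k => (krausMap V)^[k] B) A₁
  intertwines : ∀ i, V i ∘L adjoint Q = adjoint Q ∘L (creation D i).toContinuousLinearMap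
  eq_adjoint_mul_self : A₂ = adjoint Q ∘L Q
  eq_compression : A = compression J A₁ + compression J A₂
  norm_eq : ‖A‖ = ‖A₁ + A₂‖

end Dilation

end CPMap

end

noncomputable section

namespace CPMap

/-! ### Positive operators: strong limits, factorization and interpolation. -/

section Operators

open scoped ComplexOrder InnerProductSpace

variable {H : Type*} [NormedAddCommGroup H] [InnerProductSpace ℂ H] [CompleteSpace H]
  {K : Type*} [NormedAddCommGroup K] [InnerProductSpace ℂ K] [CompleteSpace K]

/-! Since `Vᵢ* J = J Tᵢ*`, compression to `H` intertwines `φ_V` with `φ_T`, so everything reduces to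
the study of `φ_V` on `𝒦`.

A representation yields a canonical decomposition. A strong limit of iterates is fixed by `φ_V`. The
intertwining of `Q*` transports `φ_S` to `φ_V`, and `φ_Sᵏ(1) → 0` on the Fock space, so `Q* Q` is a
pure solution. Both facts survive compression. A canonical decomposition `A = A' + A''` is unique
because `φ_Tᵏ(A) = A' + φ_Tᵏ(A'') → A'`.

Conversely, the hard step is `exists_lift`: a solution `A` lifts to a solution `M ≥ 0` for `φ_V`
with `‖M‖ = ‖A‖`. If `0 ≤ N ≤ ‖A‖` compresses to `A`, then `φ_V(N)` compresses to `φ_T(A) ≤ A`, and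
`exists_compression_eq` places between `φ_V(N)` and `‖A‖` an operator compressing to `A` again.
Iterating gives `φ_V(Nₖ) ≤ Nₖ₊₁`; a weak limit of the averages of the `Nₖ` is `M`.

Then `B = lim φ_Vᵏ(M)` is fixed by `φ_V`, which for isometries with orthogonal ranges puts it in the
commutant. The remainder `C = M - B` is pure, and the Poisson kernel `Q h = (Δ V_α* h)_α`, `Δ = (C -
φ_V(C))^{1/2}`, satisfies `C = Q* Q` by telescoping. -/

lemma inner_self_eq_ofReal {E : Type*} [NormedAddCommGroup E] [InnerProductSpace ℂ E] (x : E) :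
    ⟪x, x⟫_ℂ = ((‖x‖ ^ 2 : ℝ) : ℂ) := by
  rw [inner_self_eq_norm_sq_to_K]
  simp

omit [CompleteSpace H] in
lemma nonneg_iff_inner (A : H →L[ℂ] H) : 0 ≤ A ↔ ∀ x, 0 ≤ ⟪x, A x⟫_ℂ := by
  rw [nonneg_iff_isPositive]
  refine ⟨fun h x => h.inner_nonneg_right x, fun h => ?_⟩
  rw [isPositive_iff_complex]
  intro x
  have hx' : 0 ≤ ⟪A x, x⟫_ℂ := by
    rw [← inner_conj_symm]
    exact star_nonneg_iff.2 (h x)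
  exact ⟨(Complex.eq_re_of_ofReal_le hx').symm, (Complex.le_def.1 hx').1⟩

lemma le_iff_inner (A B : H →L[ℂ] H) : A ≤ B ↔ ∀ x, ⟪x, A x⟫_ℂ ≤ ⟪x, B x⟫_ℂ := by
  rw [← sub_nonneg, nonneg_iff_inner]
  simp only [sub_apply, inner_sub_right, sub_nonneg]

omit [CompleteSpace H] in
lemma ext_inner_self {A B : H →L[ℂ] H} (h : ∀ x, ⟪x, A x⟫_ℂ = ⟪x, B x⟫_ℂ) : A = B := by
  have h' : A.toLinearMap = B.toLinearMap := by
    refine (ext_inner_map _ _).1 fun x => ?_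
    have := congrArg (starRingEnd ℂ) (h x)
    simpa only [inner_conj_symm, coe_coe] using this
  exact ContinuousLinearMap.coe_injective h'

lemma norm_sq_sqrt_apply {P : H →L[ℂ] H} (hP : 0 ≤ P) (h : H) :
    ((‖CFC.sqrt P h‖ ^ 2 : ℝ) : ℂ) = ⟪h, P h⟫_ℂ := by
  have hs : CFC.sqrt P * CFC.sqrt P = P := CFC.sqrt_mul_sqrt_self P hP
  have hsa : IsSelfAdjoint (CFC.sqrt P) := (CFC.sqrt_nonneg P).isSelfAdjoint
  conv_rhs => rw [← hs, mul_apply_eq_comp, ← adjoint_inner_left, hsa.adjoint_eq]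
  exact (inner_self_eq_ofReal _).symm

/-- This Cauchy–Schwarz type bound, read off from `P = P^{1/2} P^{1/2}`, upgrades convergence of
quadratic forms to strong convergence. -/
lemma norm_sq_apply_le {P : H →L[ℂ] H} (hP : 0 ≤ P) (h : H) :
    ‖P h‖ ^ 2 ≤ ‖P‖ * (⟪h, P h⟫_ℂ).re := by
  have hs : CFC.sqrt P * CFC.sqrt P = P := CFC.sqrt_mul_sqrt_self P hP
  have hsa : IsSelfAdjoint (CFC.sqrt P) := (CFC.sqrt_nonneg P).isSelfAdjoint
  have hn : ‖P‖ = ‖CFC.sqrt P‖ * ‖CFC.sqrt P‖ := by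
    conv_lhs => rw [← hs]
    nth_rewrite 1 [← hsa.star_eq]
    exact CStarRing.norm_star_mul_self
  rw [← norm_sq_sqrt_apply hP h, Complex.ofReal_re, hn]
  have : ‖P h‖ ≤ ‖CFC.sqrt P‖ * ‖CFC.sqrt P h‖ := by
    conv_lhs => rw [← hs]
    exact le_opNorm (CFC.sqrt P) _
  calc ‖P h‖ ^ 2 ≤ (‖CFC.sqrt P‖ * ‖CFC.sqrt P h‖) ^ 2 := by gcongr
    _ = _ := by ring

omit [CompleteSpace H] in
lemma nonneg_of_isSOTLimit {X : ℕ → H →L[ℂ] H} {L : H →L[ℂ] H} (hX : IsSOTLimit X L)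
    (h0 : ∀ k, 0 ≤ X k) : 0 ≤ L := by
  rw [nonneg_iff_inner]
  intro x
  exact ge_of_tendsto' ((tendsto_const_nhds (x := x)).inner (hX x))
    fun k => (nonneg_iff_inner _).1 (h0 k) x

omit [CompleteSpace H] in
lemma IsSOTLimit.unique {X : ℕ → H →L[ℂ] H} {L M : H →L[ℂ] H} (h : IsSOTLimit X L)
    (h' : IsSOTLimit X M) : L = M := by
  ext x
  exact tendsto_nhds_unique (h x) (h' x)

/-- A decreasing sequence of positive operators converges strongly. -/
lemma exists_isSOTLimit_of_antitone {X : ℕ → H →L[ℂ] H} (hX : Antitone X) (h0 : ∀ k, 0 ≤ X k) :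
    ∃ L : H →L[ℂ] H, IsSOTLimit X L := by
  have key : ∀ h : H, ∃ y, Tendsto (fun k => X k h) atTop (𝓝 y) := by
    intro h
    apply cauchySeq_tendsto_of_complete
    let r : ℕ → ℝ := fun k => (⟪h, X k h⟫_ℂ).re
    have hr : Antitone r := fun k l hkl =>
      (Complex.le_def.1 ((le_iff_inner _ _).1 (hX hkl) h)).1
    have hr0 : BddBelow (Set.range r) := by
      refine ⟨0, ?_⟩
      rintro _ ⟨k, rfl⟩
      exact (Complex.le_def.1 ((nonneg_iff_inner _).1 (h0 k) h)).1
    have hc : CauchySeq r := (tendsto_atTop_ciInf hr hr0).cauchySeq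
    have bound : ∀ k l, k ≤ l → ‖X k h - X l h‖ ^ 2 ≤ ‖X 0‖ * (r k - r l) := by
      intro k l hkl
      have hp : 0 ≤ X k - X l := sub_nonneg.2 (hX hkl)
      have h1 := norm_sq_apply_le hp h
      have h2 : ‖X k - X l‖ ≤ ‖X 0‖ :=
        CStarAlgebra.norm_le_norm_of_nonneg_of_le hp
          ((sub_le_self _ (h0 l)).trans (hX (Nat.zero_le k)))
      have h3 : (⟪h, (X k - X l) h⟫_ℂ).re = r k - r l := by
        simp [r]
      rw [h3] at h1
      rw [sub_apply] at h1
      exact h1.trans (mul_le_mul_of_nonneg_right h2 (sub_nonneg.2 (hr hkl)))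
    rw [Metric.cauchySeq_iff'] at hc ⊢
    intro ε hε
    -- The `+ 1` keeps the denominator positive when `X 0 = 0`.
    obtain ⟨N, hN⟩ := hc (ε ^ 2 / (‖X 0‖ + 1)) (by positivity)
    refine ⟨N, fun n hn => ?_⟩
    have h1 := hN n hn
    rw [dist_comm, Real.dist_eq, abs_of_nonneg (sub_nonneg.2 (hr hn)),
      lt_div_iff₀ (by positivity)] at h1
    have h2 := bound N n hn
    have h3 : 0 ≤ r N - r n := sub_nonneg.2 (hr hn)
    rw [dist_comm, dist_eq_norm]
    refine lt_of_pow_lt_pow_left₀ 2 hε.le ?_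
    nlinarith
  choose y hy using key
  exact ⟨continuousLinearMapOfTendsto X (tendsto_pi_nhds.2 hy), hy⟩

/-- A positive operator dominated by `R* R` is of the form `R* Θ R` with `0 ≤ Θ ≤ 1`. -/
lemma exists_eq_adjoint_comp {R : H →L[ℂ] K} {Y : H →L[ℂ] H} (hY : 0 ≤ Y)
    (hYR : Y ≤ adjoint R ∘L R) :
    ∃ Θ : K →L[ℂ] K, 0 ≤ Θ ∧ Θ ≤ 1 ∧ Y = adjoint R ∘L Θ ∘L R := by
  let E : Submodule ℂ K := R.range.topologicalClosure
  have : CompleteSpace E := R.range.isClosed_topologicalClosure.completeSpace_coe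
  let e : H →ₗ[ℂ] E := R.toLinearMap.codRestrict E
    fun x => R.range.le_topologicalClosure (LinearMap.mem_range_self _ x)
  have he : DenseRange e := by
    rw [DenseRange, Subtype.dense_iff]
    intro y hy
    refine closure_mono ?_ hy
    rintro _ ⟨x, rfl⟩
    exact ⟨e x, Set.mem_range_self x, rfl⟩
  let f : H →ₗ[ℂ] H := (CFC.sqrt Y).toLinearMap
  have hfe : ∀ x, ‖f x‖ ≤ 1 * ‖e x‖ := by
    intro x
    rw [one_mul]
    have h1 := (le_iff_inner _ _).1 hYR x
    rw [← norm_sq_sqrt_apply hY, comp_apply, adjoint_inner_right, inner_self_eq_ofReal] at h1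
    have h2 : ‖CFC.sqrt Y x‖ ^ 2 ≤ ‖R x‖ ^ 2 := by exact_mod_cast h1
    exact pow_le_pow_iff_left₀ (norm_nonneg _) (norm_nonneg _) two_ne_zero |>.1 h2
  -- `R x ↦ Y^{1/2} x` is well defined and contractive because `Y ≤ R* R`. It extends to the closure
  -- of the range of `R`, and by `0` to the orthogonal complement; `Θ = G* G`.
  let G : K →L[ℂ] H := f.extendOfNorm e ∘L E.orthogonalProjectionOnto
  have hG : ∀ x, G (R x) = CFC.sqrt Y x := by
    intro x
    have h1 : E.orthogonalProjectionOnto (R x) = e x :=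
      E.orthogonalProjectionOnto_mem_subspace_eq_self (e x)
    rw [comp_apply, h1, LinearMap.extendOfNorm_eq he ⟨1, hfe⟩]
    rfl
  have hG1 : ∀ y, ‖G y‖ ≤ ‖y‖ := by
    intro y
    refine (LinearMap.norm_extendOfNorm_apply_le he 1 hfe _).trans ?_
    rw [one_mul]
    exact E.norm_orthogonalProjectionOnto_apply_le y
  refine ⟨adjoint G ∘L G, ?_, ?_, ?_⟩
  · rw [nonneg_iff_isPositive]
    exact isPositive_adjoint_comp_self G
  · rw [le_iff_inner]
    intro y
    rw [comp_apply, adjoint_inner_right, inner_self_eq_ofReal, one_apply_eq_self,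
      inner_self_eq_ofReal]
    exact_mod_cast pow_le_pow_left₀ (norm_nonneg _) (hG1 y) 2
  · refine ext_inner_self fun x => ?_
    simp only [comp_apply, adjoint_inner_right]
    rw [hG, inner_self_eq_ofReal, ← norm_sq_sqrt_apply hY]

/-- Interpolation: if `L ≤ a`, `J* L J ≤ A ≤ a`, there is `L ≤ N ≤ a` with compression `A`. -/
lemma exists_compression_eq (J : H →ₗᵢ[ℂ] K) {L a : K →L[ℂ] K} {A : H →L[ℂ] H}
    (hL : L ≤ a) (hLA : compression J L ≤ A) (hA : A ≤ compression J a) :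
    ∃ N : K →L[ℂ] K, L ≤ N ∧ N ≤ a ∧ compression J N = A := by
  have hZ : 0 ≤ a - L := sub_nonneg.2 hL
  set s := CFC.sqrt (a - L) with hs_def
  have hss : s * s = a - L := CFC.sqrt_mul_sqrt_self _ hZ
  have hsa : adjoint s = s := (CFC.sqrt_nonneg (a - L)).isSelfAdjoint.adjoint_eq
  have hc : adjoint (s ∘L J.toContinuousLinearMap) ∘L (s ∘L J.toContinuousLinearMap) =
      compression J a - compression J L := by
    ext x
    have := congrArg (fun F : K →L[ℂ] K => F (J x)) hss
    simp only [mul_apply_eq_comp, sub_apply] at this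
    simp [compression, adjoint_comp, hsa, this]

  -- With `s² = a - L`, the excess `J* a J - A` lies between `0` and `(sJ)* (sJ)`, so it equals
  -- `(sJ)* Θ (sJ)`. Subtracting `s Θ s` from `a` removes exactly this excess, and `0 ≤ Θ ≤ 1` keeps
  -- the result between `L` and `a`.
  obtain ⟨Θ, h0, h1, h2⟩ := exists_eq_adjoint_comp (R := s ∘L J.toContinuousLinearMap)
    (Y := compression J a - A) (sub_nonneg.2 hA) (by
      rw [hc]
      exact sub_le_sub_left hLA _)
  refine ⟨a - s * Θ * s, ?_, ?_, ?_⟩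
  · rw [le_sub_comm, ← hss, le_iff_inner]
    intro x
    have := (le_iff_inner _ _).1 h1 (s x)
    simp only [mul_apply_eq_comp]
    rw [← hsa, adjoint_inner_right, adjoint_inner_right, hsa]
    exact this
  · rw [sub_le_self_iff, nonneg_iff_inner]
    intro x
    have := (nonneg_iff_inner _).1 h0 (s x)
    simp only [mul_apply_eq_comp]
    rw [← adjoint_inner_left, hsa]
    exact this
  · have : compression J (a - s * Θ * s) = compression J a -
        adjoint (s ∘L J.toContinuousLinearMap) ∘L Θ ∘L s ∘L J.toContinuousLinearMap := by
      ext x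
      simp [compression, adjoint_comp, hsa]
    rw [this, ← h2, sub_sub_cancel]

/-- Bounded sequences of operators converge weakly along every ultrafilter. -/
lemma exists_weak_limit (𝒰 : Ultrafilter ℕ) {X : ℕ → H →L[ℂ] H} {C : ℝ} (hX : ∀ k, ‖X k‖ ≤ C) :
    ∃ L : H →L[ℂ] H, ∀ x y, Tendsto (fun k => ⟪x, X k y⟫_ℂ) 𝒰 (𝓝 ⟪x, L y⟫_ℂ) := by
  have bd : ∀ k x y, ‖⟪x, X k y⟫_ℂ‖ ≤ C * ‖x‖ * ‖y‖ := fun k x y =>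
    calc ‖⟪x, X k y⟫_ℂ‖ ≤ ‖x‖ * ‖X k y‖ := norm_inner_le_norm _ _
      _ ≤ ‖x‖ * (C * ‖y‖) := by
        gcongr
        exact (le_opNorm _ _).trans (by gcongr; exact hX k)
      _ = _ := by ring
  have key : ∀ x y, ∃ c : ℂ, Tendsto (fun k => ⟪x, X k y⟫_ℂ) 𝒰 (𝓝 c) := by
    intro x y
    obtain ⟨c, -, hc⟩ := (isCompact_closedBall (0 : ℂ) (C * ‖x‖ * ‖y‖)).ultrafilter_le_nhds
      (𝒰.map fun k => ⟪x, X k y⟫_ℂ) (by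
        rw [Ultrafilter.coe_map, le_principal_iff, mem_map]
        exact univ_mem' fun k => by simpa using bd k x y)
    exact ⟨c, hc⟩
  choose b hb using key
  let B : H →L⋆[ℂ] H →L[ℂ] ℂ := LinearMap.mkContinuous₂
    (LinearMap.mk₂'ₛₗ (starRingEnd ℂ) (RingHom.id ℂ) b
      (fun x x' y => tendsto_nhds_unique (hb _ _)
        (((hb x y).add (hb x' y)).congr fun k => (inner_add_left _ _ _).symm))
      (fun c x y => tendsto_nhds_unique (hb _ _)
        (((hb x y).const_mul _).congr fun k => (inner_smul_left _ _ _).symm))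
      (fun x y y' => tendsto_nhds_unique (hb _ _)
        (((hb x y).add (hb x y')).congr fun k => by rw [map_add, inner_add_right]))
      (fun c x y => tendsto_nhds_unique (hb _ _)
        (((hb x y).const_mul _).congr fun k => by rw [map_smul, inner_smul_right]; simp)))
    C (fun x y => le_of_tendsto' (hb x y).norm fun k => bd k x y)
  -- The operator attached to a form acts in the first slot of the inner product; the adjoint moves
  -- it to the second.
  refine ⟨adjoint (InnerProductSpace.continuousLinearMapOfBilin B), fun x y => ?_⟩
  rw [adjoint_inner_right, InnerProductSpace.continuousLinearMapOfBilin_apply]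
  exact hb x y

end Operators

/-! ### The map `φ_T` on bounded operators. -/

section Kraus

open scoped ComplexOrder InnerProductSpace

variable {ι : Type*} {H : Type*} [NormedAddCommGroup H] [InnerProductSpace ℂ H] [CompleteSpace H]
  {K : Type*} [NormedAddCommGroup K] [InnerProductSpace ℂ K] [CompleteSpace K]
  {T : ι → H →L[ℂ] H} {V : ι → K →L[ℂ] K}

/-- Matrix coefficients determine `φ_T`; together with `eq_krausMap` this replaces the weak operator
sum by scalar series. -/
lemma hasSum_krausMap (hT : KrausSummable T) (X : H →L[ℂ] H) (h k : H) :
    HasSum (fun i => ⟪adjoint (T i) h, X (adjoint (T i) k)⟫_ℂ) ⟪h, krausMap T X k⟫_ℂ := by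
  have h1 := ContinuousLinearMapWOT.tendsto_iff_forall_inner_apply_tendsto.1 (hT X).hasSum k h
  refine h1.congr fun F => ?_
  have h2 : ∀ F : Finset ι, (∑ i ∈ F, ContinuousLinearMapWOT.ofCLM (T i * X * adjoint (T i))) k =
      ∑ i ∈ F, T i (X (adjoint (T i) k)) := by
    classical
    intro F
    induction F using Finset.induction_on with
    | empty => simp
    | insert a s ha ih =>
      rw [Finset.sum_insert ha, Finset.sum_insert ha, ContinuousLinearMapWOT.add_apply, ih]
      rfl
  rw [h2, inner_sum]
  exact Finset.sum_congr rfl fun i _ => (adjoint_inner_left _ _ _).symm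

lemma eq_krausMap (hT : KrausSummable T) {X Y : H →L[ℂ] H}
    (h : ∀ h k, HasSum (fun i => ⟪adjoint (T i) h, X (adjoint (T i) k)⟫_ℂ) ⟪h, Y k⟫_ℂ) :
    krausMap T X = Y := by
  ext k
  exact ext_inner_left ℂ fun v => (hasSum_krausMap hT X v k).unique (h v k)

lemma krausMap_add (hT : KrausSummable T) (X Y : H →L[ℂ] H) :
    krausMap T (X + Y) = krausMap T X + krausMap T Y := by
  refine eq_krausMap hT fun h k => ?_
  simp only [add_apply, inner_add_right]
  exact (hasSum_krausMap hT X h k).add (hasSum_krausMap hT Y h k)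

lemma krausMap_smul (hT : KrausSummable T) (c : ℂ) (X : H →L[ℂ] H) :
    krausMap T (c • X) = c • krausMap T X := by
  refine eq_krausMap hT fun h k => ?_
  simp only [smul_apply, inner_smul_right]
  exact (hasSum_krausMap hT X h k).mul_left c

lemma krausMap_sub (hT : KrausSummable T) (X Y : H →L[ℂ] H) :
    krausMap T (X - Y) = krausMap T X - krausMap T Y := by
  refine eq_krausMap hT fun h k => ?_
  simp only [sub_apply, inner_sub_right]
  exact (hasSum_krausMap hT X h k).sub (hasSum_krausMap hT Y h k)

lemma krausMap_zero (hT : KrausSummable T) : krausMap T 0 = 0 :=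
  eq_krausMap hT fun h k => by simp

lemma krausMap_mono (hT : KrausSummable T) : Monotone (krausMap T) := by
  intro X Y hXY
  rw [le_iff_inner] at hXY ⊢
  exact fun x => hasSum_le (fun i => hXY _) (hasSum_krausMap hT X x x) (hasSum_krausMap hT Y x x)

lemma krausMap_nonneg (hT : KrausSummable T) {X : H →L[ℂ] H} (hX : 0 ≤ X) : 0 ≤ krausMap T X := by
  simpa only [krausMap_zero hT] using krausMap_mono hT hX

lemma krausMap_iterate_nonneg (hT : KrausSummable T) {X : H →L[ℂ] H} (hX : 0 ≤ X) (k : ℕ) :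
    0 ≤ (krausMap T)^[k] X := by
  induction k with
  | zero => exact hX
  | succ k ih =>
    rw [Function.iterate_succ_apply']
    exact krausMap_nonneg hT ih

lemma krausMap_iterate_sub (hT : KrausSummable T) (X Y : H →L[ℂ] H) (k : ℕ) :
    (krausMap T)^[k] (X - Y) = (krausMap T)^[k] X - (krausMap T)^[k] Y := by
  induction k with
  | zero => rfl
  | succ k ih => simp only [Function.iterate_succ_apply', ih, krausMap_sub hT]

lemma krausMap_iterate_add (hT : KrausSummable T) (X Y : H →L[ℂ] H) (k : ℕ) :
    (krausMap T)^[k] (X + Y) = (krausMap T)^[k] X + (krausMap T)^[k] Y := by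
  induction k with
  | zero => rfl
  | succ k ih => simp only [Function.iterate_succ_apply', ih, krausMap_add hT]

lemma antitone_krausMap_iterate (hT : KrausSummable T) {X : H →L[ℂ] H} (hX : krausMap T X ≤ X) :
    Antitone fun k => (krausMap T)^[k] X :=
  (krausMap_mono hT).antitone_iterate_of_map_le hX

lemma summable_norm_sq_adjoint (hT : KrausSummable T) (h : H) :
    Summable fun i => ‖adjoint (T i) h‖ ^ 2 := by
  have h1 := (hasSum_krausMap hT 1 h h).summable
  simp only [one_apply_eq_self, inner_self_eq_ofReal] at h1
  exact Complex.summable_ofReal.1 h1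

/-- Sequential normality of `φ_T` on strongly convergent sequences. -/
lemma tendsto_inner_krausMap (hT : KrausSummable T) {X : ℕ → H →L[ℂ] H} {L : H →L[ℂ] H}
    (hX : IsSOTLimit X L) (h k : H) :
    Tendsto (fun n => ⟪h, krausMap T (X n) k⟫_ℂ) atTop (𝓝 ⟪h, krausMap T L k⟫_ℂ) := by
  obtain ⟨C, hC⟩ : ∃ C, ∀ n, ‖X n‖ ≤ C := by
    refine banach_steinhaus fun x => ?_
    obtain ⟨C, hC⟩ := (hX x).norm.bddAbove_range
    exact ⟨C, fun n => hC ⟨n, rfl⟩⟩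
  simp only [← (hasSum_krausMap hT _ h k).tsum_eq]
  -- The dominating series is summable because `φ_T(1)` exists; `C` is the uniform bound from
  -- Banach–Steinhaus.
  refine tendsto_tsum_of_dominated_convergence
    (bound := fun i => C * (‖adjoint (T i) h‖ ^ 2 + ‖adjoint (T i) k‖ ^ 2))
    (((summable_norm_sq_adjoint hT h).add (summable_norm_sq_adjoint hT k)).mul_left C)
    (fun i => tendsto_const_nhds.inner (hX _)) (Eventually.of_forall fun n i => ?_)
  have h0 : 0 ≤ C := (norm_nonneg _).trans (hC 0)
  calc ‖⟪adjoint (T i) h, X n (adjoint (T i) k)⟫_ℂ‖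
      ≤ ‖adjoint (T i) h‖ * ‖X n (adjoint (T i) k)‖ := norm_inner_le_norm _ _
    _ ≤ ‖adjoint (T i) h‖ * (C * ‖adjoint (T i) k‖) := by
        gcongr
        exact (le_opNorm _ _).trans (by gcongr; exact hC n)
    _ = C * (‖adjoint (T i) h‖ * ‖adjoint (T i) k‖) := by ring
    _ ≤ _ := by
        gcongr
        nlinarith [sq_nonneg (‖adjoint (T i) h‖ - ‖adjoint (T i) k‖),
          sq_nonneg (‖adjoint (T i) h‖), sq_nonneg (‖adjoint (T i) k‖)]

/-- By normality `φ(φᵏ(X))` tends weakly to `φ(L)`, while as a shifted sequence it tends to `L`. -/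
lemma krausMap_eq_self_of_isSOTLimit (hT : KrausSummable T) {X L : H →L[ℂ] H}
    (hX : IsSOTLimit (fun k => (krausMap T)^[k] X) L) : krausMap T L = L := by
  ext k
  refine ext_inner_left ℂ fun h => ?_
  refine tendsto_nhds_unique (tendsto_inner_krausMap hT hX h k) ?_
  have h1 := ((hX k).comp (tendsto_add_atTop_nat 1))
  refine (tendsto_const_nhds.inner h1).congr fun n => ?_
  simp [Function.iterate_succ_apply']

/-- An operator intertwining the adjoints intertwines the associated maps. -/
lemma krausMap_conj (hT : KrausSummable T) (hV : KrausSummable V) {W : H →L[ℂ] K}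
    (hW : ∀ i h, adjoint (V i) (W h) = W (adjoint (T i) h)) (Y : K →L[ℂ] K) :
    krausMap T (adjoint W ∘L Y ∘L W) = adjoint W ∘L krausMap V Y ∘L W := by
  refine eq_krausMap hT fun h k => ?_
  simp only [comp_apply, adjoint_inner_right W, ← hW]
  exact hasSum_krausMap hV Y (W h) (W k)

lemma krausMap_iterate_conj (hT : KrausSummable T) (hV : KrausSummable V) {W : H →L[ℂ] K}
    (hW : ∀ i h, adjoint (V i) (W h) = W (adjoint (T i) h)) (Y : K →L[ℂ] K) (k : ℕ) :
    (krausMap T)^[k] (adjoint W ∘L Y ∘L W) = adjoint W ∘L (krausMap V)^[k] Y ∘L W := by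
  induction k with
  | zero => rfl
  | succ k ih => rw [Function.iterate_succ_apply', ih, krausMap_conj hT hV hW,
      Function.iterate_succ_apply']

end Kraus

/-! ### Isometries with orthogonal ranges. -/

section Isometries

open scoped ComplexOrder InnerProductSpace

variable {ι : Type*} {K : Type*} [NormedAddCommGroup K] [InnerProductSpace ℂ K] [CompleteSpace K]
  {V : ι → K →L[ℂ] K}

/-- The `Vᵢ` are isometries with pairwise orthogonal ranges. -/
structure IsOrthogonalIsometries (V : ι → K →L[ℂ] K) : Prop where
  isometry : ∀ i, adjoint (V i) * V i = 1
  orthogonal : ∀ i j, i ≠ j → adjoint (V i) * V j = 0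

namespace IsOrthogonalIsometries

lemma adjoint_apply_self (hV : IsOrthogonalIsometries V) (i : ι) (x : K) :
    adjoint (V i) (V i x) = x := by
  simpa using congrArg (fun F : K →L[ℂ] K => F x) (hV.isometry i)

lemma adjoint_apply_of_ne (hV : IsOrthogonalIsometries V) {i j : ι} (hij : i ≠ j) (x : K) :
    adjoint (V i) (V j x) = 0 := by
  simpa using congrArg (fun F : K →L[ℂ] K => F x) (hV.orthogonal i j hij)

/-- The `i`-th operator as a linear isometry. -/
def toLinearIsometry (hV : IsOrthogonalIsometries V) (i : ι) : K →ₗᵢ[ℂ] K where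
  toLinearMap := (V i).toLinearMap
  norm_map' x := by
    have h1 : ⟪V i x, V i x⟫_ℂ = ⟪x, x⟫_ℂ := by
      rw [← adjoint_inner_right, hV.adjoint_apply_self]
    rw [inner_self_eq_ofReal, inner_self_eq_ofReal] at h1
    exact (sq_eq_sq₀ (norm_nonneg _) (norm_nonneg _)).1 (by exact_mod_cast h1)

lemma orthogonalFamily (hV : IsOrthogonalIsometries V) :
    OrthogonalFamily ℂ (fun _ : ι => K) hV.toLinearIsometry := by
  intro i j hij x y
  change ⟪V i x, V j y⟫_ℂ = 0
  rw [← adjoint_inner_right, hV.adjoint_apply_of_ne hij, inner_zero_right]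

/-- Bessel's inequality: `p` is the projection of `h` onto the sum of the ranges, so `‖p‖² = ⟪h, p⟫
≤ ‖h‖ ‖p‖`. -/
lemma sum_norm_sq_adjoint_le (hV : IsOrthogonalIsometries V) (F : Finset ι) (h : K) :
    ∑ i ∈ F, ‖adjoint (V i) h‖ ^ 2 ≤ ‖h‖ ^ 2 := by
  set p := ∑ i ∈ F, V i (adjoint (V i) h)
  have h1 : ‖p‖ ^ 2 = ∑ i ∈ F, ‖adjoint (V i) h‖ ^ 2 :=
    hV.orthogonalFamily.norm_sum (fun i => adjoint (V i) h) F
  have h2 : ⟪h, p⟫_ℂ = ((∑ i ∈ F, ‖adjoint (V i) h‖ ^ 2 : ℝ) : ℂ) := by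
    rw [inner_sum, Complex.ofReal_sum]
    refine Finset.sum_congr rfl fun i _ => ?_
    rw [← adjoint_inner_left, inner_self_eq_ofReal]
  rw [← h1] at h2 ⊢
  have h3 := norm_inner_le_norm (𝕜 := ℂ) h p
  rw [h2, Complex.norm_real, Real.norm_of_nonneg (sq_nonneg _)] at h3
  nlinarith [norm_nonneg h, norm_nonneg p, sq_nonneg (‖h‖ - ‖p‖)]

lemma summable_apply (hV : IsOrthogonalIsometries V) (X : K →L[ℂ] K) (h : K) :
    Summable fun i => V i (X (adjoint (V i) h)) := by
  refine (hV.orthogonalFamily.summable_iff_norm_sq_summable fun i => X (adjoint (V i) h)).2 ?_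
  have h1 : Summable fun i => ‖adjoint (V i) h‖ ^ 2 :=
    summable_of_sum_le (fun i => sq_nonneg _) fun F => hV.sum_norm_sq_adjoint_le F h
  refine (h1.mul_left (‖X‖ ^ 2)).of_nonneg_of_le (fun i => sq_nonneg _) fun i => ?_
  rw [← mul_pow]
  exact pow_le_pow_left₀ (norm_nonneg _) (le_opNorm _ _) 2

lemma krausSummable [Countable ι] (hV : IsOrthogonalIsometries V) : KrausSummable V := by
  intro X
  have h1 : ∀ h : K, Tendsto (fun F : Finset ι => (∑ i ∈ F, V i * X * adjoint (V i)) h) atTop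
      (𝓝 (∑' i, V i (X (adjoint (V i) h)))) := by
    intro h
    refine (hV.summable_apply X h).hasSum.congr fun F => ?_
    simp
  let L : K →L[ℂ] K := continuousLinearMapOfTendsto _ (tendsto_pi_nhds.2 h1)
  refine ⟨ContinuousLinearMapWOT.ofCLM L, ?_⟩
  refine ContinuousLinearMapWOT.tendsto_iff_forall_inner_apply_tendsto.2 fun x y => ?_
  refine (tendsto_const_nhds.inner (h1 x)).congr fun F => ?_
  have h2 : ContinuousLinearMapWOT.ofCLM (∑ i ∈ F, V i * X * adjoint (V i)) =
      ∑ i ∈ F, ContinuousLinearMapWOT.ofCLM (V i * X * adjoint (V i)) :=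
    map_sum (ContinuousLinearMap.WOTofCLM (σ := RingHom.id ℂ) (E := K) (F := K)) _ F
  rw [← h2]
  rfl

/-- Applying `Vⱼ*` leaves only the `j`-th term of the series, by orthogonality of the ranges. -/
lemma adjoint_apply_krausMap [Countable ι] (hV : IsOrthogonalIsometries V) (X : K →L[ℂ] K)
    (j : ι) (k : K) : adjoint (V j) (krausMap V X k) = X (adjoint (V j) k) := by
  refine ext_inner_left ℂ fun h => ?_
  rw [adjoint_inner_right]
  refine (hasSum_krausMap hV.krausSummable X _ k).unique ?_
  convert! hasSum_single j fun i hij => ?_ using 2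
  · rw [hV.adjoint_apply_self]
  · rw [hV.adjoint_apply_of_ne hij, inner_zero_left]

lemma krausMap_one_le [Countable ι] (hV : IsOrthogonalIsometries V) : krausMap V 1 ≤ 1 := by
  rw [le_iff_inner]
  intro x
  refine hasSum_le_of_sum_le (hasSum_krausMap hV.krausSummable 1 x x) fun F => ?_
  simp only [one_apply_eq_self, inner_self_eq_ofReal]
  rw [← Complex.ofReal_sum]
  exact_mod_cast hV.sum_norm_sq_adjoint_le F x

/-- `Vⱼ* X = Vⱼ* φ_V(X) = X Vⱼ*`; selfadjointness of `X` gives the relation with `Vⱼ` by taking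
adjoints. -/
lemma inCommutant_of_fixed [Countable ι] (hV : IsOrthogonalIsometries V) {X : K →L[ℂ] K}
    (hX : IsSelfAdjoint X) (hfix : krausMap V X = X) : InCommutant V X := by
  have h1 : ∀ j, adjoint (V j) * X = X * adjoint (V j) := by
    intro j
    ext k
    have := hV.adjoint_apply_krausMap X j k
    rw [hfix] at this
    simpa using this
  rw [InCommutant, Set.mem_centralizer_iff]
  rintro _ (⟨j, rfl⟩ | ⟨j, rfl⟩)
  · have := congrArg star (h1 j)
    rw [star_mul, star_mul, hX.star_eq, ← star_eq_adjoint, star_star] at this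
    exact this.symm
  · exact h1 j

lemma krausMap_commutant_mul [Countable ι] (hV : IsOrthogonalIsometries V) {B : K →L[ℂ] K}
    (hB : InCommutant V B) (Y : K →L[ℂ] K) : krausMap V (B * Y) = B * krausMap V Y := by
  have h1 : ∀ i x, adjoint (V i) (adjoint B x) = adjoint B (adjoint (V i) x) := by
    intro i x
    have h2 := Set.mem_centralizer_iff.1 hB (V i) (Or.inl ⟨i, rfl⟩)
    have h3 := congrArg (fun F : K →L[ℂ] K => star F x) h2
    simp only [star_mul, star_eq_adjoint, mul_apply_eq_comp] at h3
    exact h3.symm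
  refine eq_krausMap hV.krausSummable fun h k => ?_
  simp only [mul_apply_eq_comp]
  rw [← adjoint_inner_left]
  refine (hasSum_krausMap hV.krausSummable Y (adjoint B h) k).congr_fun ?_
  intro i
  rw [h1]
  exact (adjoint_inner_left _ _ _).symm

/-- An element of the commutant factors out of the series, so `φ_Vᵏ(B) = B φ_Vᵏ(1)`, and `φ_Vᵏ(1)`
decreases. -/
lemma exists_isSOTLimit_iterate [Countable ι] (hV : IsOrthogonalIsometries V) {B : K →L[ℂ] K}
    (hB : InCommutant V B) :
    ∃ A₁ : K →L[ℂ] K, IsSOTLimit (fun k => (krausMap V)^[k] B) A₁ := by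
  obtain ⟨P, hP⟩ := exists_isSOTLimit_of_antitone
    (antitone_krausMap_iterate hV.krausSummable hV.krausMap_one_le)
    (krausMap_iterate_nonneg hV.krausSummable zero_le_one)
  have h1 : ∀ k, (krausMap V)^[k] B = B * (krausMap V)^[k] 1 := by
    intro k
    induction k with
    | zero => simp
    | succ k ih => rw [Function.iterate_succ_apply', ih, hV.krausMap_commutant_mul hB,
        Function.iterate_succ_apply']
  refine ⟨B * P, fun x => ?_⟩
  simp only [h1, mul_apply_eq_comp]
  exact (B.continuous.tendsto _).comp (hP x)

end IsOrthogonalIsometries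

end Isometries

/-! ### Creation operators on the Fock space. -/

section FockSpace

open scoped ComplexOrder InnerProductSpace

variable {ι : Type*} {D : Type*} [NormedAddCommGroup D] [InnerProductSpace ℂ D] [CompleteSpace D]

omit [CompleteSpace D] in
lemma creation_apply_of_forall_ne (i : ι) (f : Fock ι D) {w : FreeMonoid ι}
    (h : ∀ α, FreeMonoid.of i * α ≠ w) : creation D i f w = 0 :=
  Function.extend_apply' _ _ _ fun ⟨α, hα⟩ => h α hα

lemma isOrthogonalIsometries_creation :
    IsOrthogonalIsometries fun i : ι => (creation D i).toContinuousLinearMap where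
  isometry i := by
    ext1 f
    refine ext_inner_left ℂ fun g => ?_
    rw [mul_apply_eq_comp, adjoint_inner_right]
    exact (creation D i).inner_map_map g f
  orthogonal i j hij := by
    ext1 f
    refine ext_inner_left ℂ fun g => ?_
    rw [mul_apply_eq_comp, adjoint_inner_right, zero_apply, inner_zero_right]
    change ⟪creation D i g, creation D j f⟫_ℂ = 0
    rw [lp.inner_eq_tsum]
    refine (tsum_congr fun w => ?_).trans tsum_zero
    by_cases h : ∃ α, FreeMonoid.of i * α = w
    · obtain ⟨α, rfl⟩ := h
      rw [creation_apply_of_forall_ne j f, inner_zero_right]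
      intro β hβ
      exact hij (List.cons.inj hβ).1.symm
    · rw [creation_apply_of_forall_ne i g fun α hα => h ⟨α, hα⟩, inner_zero_left]

omit [CompleteSpace D] in
lemma inner_single [DecidableEq (FreeMonoid ι)] (α : FreeMonoid ι) (d : D) (f : Fock ι D) :
    ⟪(lp.single 2 α d : Fock ι D), f⟫_ℂ = ⟪d, f α⟫_ℂ :=
  lp.inner_single_left α d f

lemma adjoint_creation_apply (i : ι) (f : Fock ι D) (α : FreeMonoid ι) :
    adjoint (creation D i).toContinuousLinearMap f α = f (FreeMonoid.of i * α) := by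
  classical
  refine ext_inner_left ℂ fun d => ?_
  refine (inner_single α d _).symm.trans ?_
  rw [adjoint_inner_right]
  change ⟪creation D i (lp.single 2 α d), f⟫_ℂ = _
  rw [creation_single, inner_single]

/-- `φ_S^k(I) → 0` strongly for the creation operators. -/
lemma isSOTLimit_krausMap_creation [Countable ι] :
    IsSOTLimit (fun k => (krausMap fun i : ι => (creation D i).toContinuousLinearMap)^[k] 1) 0 := by
  have hS := isOrthogonalIsometries_creation (ι := ι) (D := D)
  obtain ⟨R, hR⟩ := exists_isSOTLimit_of_antitone
    (antitone_krausMap_iterate hS.krausSummable hS.krausMap_one_le)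
    (krausMap_iterate_nonneg hS.krausSummable zero_le_one)
  have hfix := krausMap_eq_self_of_isSOTLimit hS.krausSummable hR
  -- The limit `R` is fixed by `φ_S`, so `Sᵢ* R = R Sᵢ*`. The coordinate of `R f` at the empty word
  -- vanishes since every `Sᵢ*` kills the vacuum vectors; a first letter is stripped off by `Sᵢ*`,
  -- which shortens the word.
  have key : ∀ (α : FreeMonoid ι) (f : Fock ι D), R f α = 0 := by
    intro α
    induction α using FreeMonoid.recOn with
    | one =>
      classical
      intro f
      refine ext_inner_left ℂ fun d => ?_
      refine (inner_single 1 d (R f)).symm.trans ?_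
      rw [← hfix, inner_zero_right]
      refine (hasSum_krausMap hS.krausSummable R _ f).unique ?_
      convert! hasSum_zero using 2 with i
      have : adjoint (creation D i).toContinuousLinearMap (lp.single 2 1 d) = 0 := by
        ext β
        rw [adjoint_creation_apply, lp.single_apply, Pi.single_eq_of_ne]
        · rfl
        · exact List.cons_ne_nil _ _
      rw [this, inner_zero_left]
    | of_mul i α ih =>
      intro f
      rw [← adjoint_creation_apply, ← hfix, hS.adjoint_apply_krausMap]
      exact ih _
  have : R = 0 := by
    ext f α
    exact key α f
  rwa [this] at hR

end FockSpace

/-! ### From a representation to the canonical decomposition. -/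

section Representation

open scoped ComplexOrder InnerProductSpace

variable {ι : Type*} {H : Type*} [NormedAddCommGroup H] [InnerProductSpace ℂ H] [CompleteSpace H]
  {K : Type*} [NormedAddCommGroup K] [InnerProductSpace ℂ K] [CompleteSpace K]
  {D : Type*} [NormedAddCommGroup D] [InnerProductSpace ℂ D] [CompleteSpace D]
  {T : ι → H →L[ℂ] H} {V : ι → K →L[ℂ] K} {J : H →ₗᵢ[ℂ] K}

lemma IsMinimalIsometricDilation.isOrthogonalIsometries
    (hV : IsMinimalIsometricDilation T J V) : IsOrthogonalIsometries V :=
  ⟨hV.isometry, hV.orthogonal⟩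

lemma IsMinimalIsometricDilation.krausMap_compression [Countable ι] (hT : KrausSummable T)
    (hV : IsMinimalIsometricDilation T J V) (Y : K →L[ℂ] K) :
    krausMap T (compression J Y) = compression J (krausMap V Y) :=
  krausMap_conj (W := J.toContinuousLinearMap) hT hV.isOrthogonalIsometries.krausSummable
    (fun i h => hV.adjoint_apply i h) Y

lemma IsMinimalIsometricDilation.krausMap_iterate_compression [Countable ι] (hT : KrausSummable T)
    (hV : IsMinimalIsometricDilation T J V) (Y : K →L[ℂ] K) (k : ℕ) :
    (krausMap T)^[k] (compression J Y) = compression J ((krausMap V)^[k] Y) :=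
  krausMap_iterate_conj (W := J.toContinuousLinearMap) hT
    hV.isOrthogonalIsometries.krausSummable (fun i h => hV.adjoint_apply i h) Y k

lemma compression_mono (J : H →ₗᵢ[ℂ] K) {X Y : K →L[ℂ] K} (h : X ≤ Y) :
    compression J X ≤ compression J Y := by
  rw [le_iff_inner] at h ⊢
  intro x
  simp only [compression, comp_apply, adjoint_inner_right]
  exact h _

lemma compression_add (J : H →ₗᵢ[ℂ] K) (X Y : K →L[ℂ] K) :
    compression J (X + Y) = compression J X + compression J Y := by
  ext x
  simp [compression]

@[simp]
lemma compression_zero (J : H →ₗᵢ[ℂ] K) : compression J (0 : K →L[ℂ] K) = 0 := by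
  ext x
  simp [compression]

lemma IsSOTLimit.compression {X : ℕ → K →L[ℂ] K} {L : K →L[ℂ] K} (hX : IsSOTLimit X L)
    (J : H →ₗᵢ[ℂ] K) :
    IsSOTLimit (fun k => CPMap.compression J (X k)) (CPMap.compression J L) := fun h =>
  ((adjoint J.toContinuousLinearMap).continuous.tendsto _).comp (hX (J h))

/-- If `V Q* = Q* (S ⊗ I)`, then `Q* Q` is a pure solution of `φ_V(X) ≤ X`. -/
lemma isPureSolution_adjoint_comp_self [Countable ι] (hV : KrausSummable V) {Q : K →L[ℂ] Fock ι D}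
    (hQ : ∀ i, V i ∘L adjoint Q = adjoint Q ∘L (creation D i).toContinuousLinearMap) :
    IsPureSolution (krausMap V) (adjoint Q ∘L Q) := by
  have hS := isOrthogonalIsometries_creation (ι := ι) (D := D)
  have hQ' : ∀ i h, adjoint (creation D i).toContinuousLinearMap (Q h) =
      Q (adjoint (V i) h) := by
    intro i h
    have := congrArg (fun F => adjoint F h) (hQ i)
    simp only [adjoint_comp, adjoint_adjoint, comp_apply] at this
    exact this.symm
  have h1 : adjoint Q ∘L Q = adjoint Q ∘L (1 : Fock ι D →L[ℂ] Fock ι D) ∘L Q := rfl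
  constructor
  · rw [h1, krausMap_conj hV hS.krausSummable hQ', le_iff_inner]
    intro x
    have := (le_iff_inner _ _).1 hS.krausMap_one_le (Q x)
    simpa only [comp_apply, adjoint_inner_right] using this
  · intro h
    simp only [h1, krausMap_iterate_conj hV hS.krausSummable hQ']
    have := ((adjoint Q).continuous.tendsto _).comp (isSOTLimit_krausMap_creation (Q h))
    rw [zero_apply, map_zero] at this
    exact this

/-- This gives uniqueness: the fixed part is recovered from `A` alone. -/
lemma IsCanonicalDecomposition.isSOTLimit (hT : KrausSummable T) {A B C : H →L[ℂ] H}
    (h : IsCanonicalDecomposition (krausMap T) A B C) :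
    IsSOTLimit (fun k => (krausMap T)^[k] A) B := by
  intro x
  have h1 : ∀ k, (krausMap T)^[k] A = B + (krausMap T)^[k] C := by
    intro k
    rw [h.sum_eq, krausMap_iterate_add hT, Function.iterate_fixed h.fixed]
  simp only [h1, add_apply]
  simpa using tendsto_const_nhds.add (h.pure.2 x)

lemma Represents.isCanonicalDecomposition [Countable ι] (hT : KrausSummable T)
    (hV : IsMinimalIsometricDilation T J V) {A : H →L[ℂ] H} (hA : 0 ≤ A) {B A₁ A₂ : K →L[ℂ] K}
    {Q : K →L[ℂ] Fock ι D} (h : Represents J V A B Q A₁ A₂) :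
    IsCanonicalDecomposition (krausMap T) A (compression J A₁) (compression J A₂) := by
  have hVS := hV.isOrthogonalIsometries.krausSummable
  have hpure := isPureSolution_adjoint_comp_self hVS h.intertwines
  rw [← h.eq_adjoint_mul_self] at hpure
  have h2 : 0 ≤ compression J A₂ := by
    have : 0 ≤ A₂ := by
      rw [h.eq_adjoint_mul_self, nonneg_iff_isPositive]
      exact isPositive_adjoint_comp_self Q
    simpa using compression_mono J this
  refine ⟨?_, ?_, h2, ⟨?_, ?_⟩, h.eq_compression⟩
  -- `B` need not be selfadjoint; the compression of `A₁` is, being the difference of `A` and the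
  -- compression of `A₂`.
  · rw [← sub_eq_iff_eq_add.2 h.eq_compression]
    exact hA.isSelfAdjoint.sub h2.isSelfAdjoint
  · rw [hV.krausMap_compression hT, krausMap_eq_self_of_isSOTLimit hVS h.limit]
  · rw [hV.krausMap_compression hT]
    exact compression_mono J hpure.1
  · simp only [hV.krausMap_iterate_compression hT]
    simpa using hpure.2.compression J

end Representation

/-! ### Lifting solutions to the dilation space. -/

section Lifting

open scoped ComplexOrder InnerProductSpace

variable {ι : Type*} [Countable ι]
  {H : Type*} [NormedAddCommGroup H] [InnerProductSpace ℂ H] [CompleteSpace H]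
  {K : Type*} [NormedAddCommGroup K] [InnerProductSpace ℂ K] [CompleteSpace K]
  {T : ι → H →L[ℂ] H} {V : ι → K →L[ℂ] K} {J : H →ₗᵢ[ℂ] K}

lemma ofReal_smul_le_smul {X Y : H →L[ℂ] H} (h : X ≤ Y) {c : ℝ} (hc : 0 ≤ c) :
    (c : ℂ) • X ≤ (c : ℂ) • Y := by
  rw [le_iff_inner] at h ⊢
  intro x
  simp only [smul_apply, inner_smul_right]
  exact mul_le_mul_of_nonneg_left (h x) (by exact_mod_cast hc)

lemma le_norm_smul_one {A : H →L[ℂ] H} (hA : 0 ≤ A) : A ≤ (‖A‖ : ℂ) • (1 : H →L[ℂ] H) := by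
  have h := hA.isSelfAdjoint.le_algebraMap_norm_self
  rw [Algebra.algebraMap_eq_smul_one] at h
  rwa [← Complex.coe_smul] at h

lemma compression_smul (J : H →ₗᵢ[ℂ] K) (c : ℂ) (X : K →L[ℂ] K) :
    compression J (c • X) = c • compression J X := by
  ext x
  simp [compression]

lemma compression_one (J : H →ₗᵢ[ℂ] K) : compression J (1 : K →L[ℂ] K) = 1 := by
  refine ext_inner_self fun x => ?_
  simp only [compression, comp_apply, adjoint_inner_right]
  exact J.inner_map_map x x

lemma norm_compression_le (J : H →ₗᵢ[ℂ] K) (X : K →L[ℂ] K) : ‖compression J X‖ ≤ ‖X‖ := by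
  have hJ : ‖J.toContinuousLinearMap‖ ≤ 1 := J.norm_toContinuousLinearMap_le
  calc ‖compression J X‖ ≤ ‖adjoint J.toContinuousLinearMap‖ *
        (‖X‖ * ‖J.toContinuousLinearMap‖) :=
        (opNorm_comp_le _ _).trans (by gcongr; exact opNorm_comp_le _ _)
    _ ≤ 1 * (‖X‖ * 1) := by
        gcongr
        rw [LinearIsometryEquiv.norm_map]
        exact hJ
    _ = ‖X‖ := by ring

/-- A solution `A` of `φ_T(X) ≤ X` has liftings `Nₖ` with `φ_V(Nₖ) ≤ Nₖ₊₁`. -/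
lemma IsMinimalIsometricDilation.exists_sequence_lift (hT : KrausSummable T)
    (hV : IsMinimalIsometricDilation T J V) {A : H →L[ℂ] H} (hA : 0 ≤ A)
    (hTA : krausMap T A ≤ A) :
    ∃ N : ℕ → K →L[ℂ] K, (∀ k, 0 ≤ N k) ∧ (∀ k, N k ≤ (‖A‖ : ℂ) • (1 : K →L[ℂ] K)) ∧
      (∀ k, compression J (N k) = A) ∧ ∀ k, krausMap V (N k) ≤ N (k + 1) := by
  have hO := hV.isOrthogonalIsometries
  have hVS := hO.krausSummable
  set a : K →L[ℂ] K := (‖A‖ : ℂ) • 1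
  have ha0 : 0 ≤ a := by
    rw [← smul_zero (‖A‖ : ℂ)]
    exact ofReal_smul_le_smul zero_le_one (norm_nonneg A)
  have hAa : A ≤ compression J a := by
    rw [compression_smul, compression_one]
    exact le_norm_smul_one hA
  have hVa : krausMap V a ≤ a := by
    rw [krausMap_smul hVS]
    exact ofReal_smul_le_smul hO.krausMap_one_le (norm_nonneg A)
  let S : Set (K →L[ℂ] K) := {N | 0 ≤ N ∧ N ≤ a ∧ compression J N = A}
  obtain ⟨N₀, h0, h1, h2⟩ := exists_compression_eq J ha0 (by simpa using hA) hAa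
  have step : ∀ N : S, ∃ N' : S, krausMap V N ≤ N' := by
    rintro ⟨N, hN0, hN1, hN2⟩
    -- The lower bound `φ_V(N)` compresses to `φ_T(A)`; this is where `φ_T(A) ≤ A` enters.
    obtain ⟨N', h0, h1, h2⟩ := exists_compression_eq J (L := krausMap V N) (a := a) (A := A)
      ((krausMap_mono hVS hN1).trans hVa)
      (by rwa [← hV.krausMap_compression hT, hN2]) hAa
    exact ⟨⟨N', (krausMap_nonneg hVS hN0).trans h0, h1, h2⟩, h0⟩
  choose g hg using step
  let N : ℕ → S := fun k => g^[k] ⟨N₀, h0, h1, h2⟩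
  refine ⟨fun k => N k, fun k => (N k).2.1, fun k => (N k).2.2.1, fun k => (N k).2.2.2,
    fun k => ?_⟩
  simp only [N, Function.iterate_succ_apply']
  exact hg _

/-- Almost invariant liftings of a solution of `φ_T(X) ≤ X`, obtained by averaging. -/
lemma IsMinimalIsometricDilation.exists_almost_lift (hT : KrausSummable T)
    (hV : IsMinimalIsometricDilation T J V) {A : H →L[ℂ] H} (hA : 0 ≤ A)
    (hTA : krausMap T A ≤ A) :
    ∃ E : ℕ → K →L[ℂ] K, (∀ m, 0 ≤ E m) ∧ (∀ m, E m ≤ (‖A‖ : ℂ) • (1 : K →L[ℂ] K)) ∧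
      (∀ m, compression J (E m) = A) ∧
      ∀ m, krausMap V (E m) ≤
        E m + ((1 / ((m : ℝ) + 1) : ℝ) : ℂ) • ((‖A‖ : ℂ) • (1 : K →L[ℂ] K)) := by
  have hVS := hV.isOrthogonalIsometries.krausSummable
  obtain ⟨N, h0, h1, h2, h3⟩ := hV.exists_sequence_lift hT hA hTA
  set a : K →L[ℂ] K := (‖A‖ : ℂ) • 1
  let S : ℕ → K →L[ℂ] K := fun m => ∑ k ∈ Finset.range m, N k
  have hSs : ∀ m, S (m + 1) = S m + N m := fun m => Finset.sum_range_succ _ _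
  have hS0 : ∀ m, 0 ≤ S m := fun m => Finset.sum_nonneg fun k _ => h0 k
  have hS1 : ∀ m : ℕ, S m ≤ ((m : ℝ) : ℂ) • a := by
    intro m
    induction m with
    | zero => simp [S]
    | succ m ih =>
      rw [hSs]
      refine (add_le_add ih (h1 m)).trans_eq ?_
      push_cast
      rw [add_smul, one_smul]
  have hS2 : ∀ m : ℕ, compression J (S m) = ((m : ℝ) : ℂ) • A := by
    intro m
    induction m with
    | zero => simp [S]
    | succ m ih =>
      rw [hSs, compression_add, ih, h2]
      push_cast
      rw [add_smul, one_smul]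
  -- Summing `φ_V(Nₖ) ≤ Nₖ₊₁` over `k < m` shifts the sum by one index. Only the end terms `N 0` and
  -- `N m` differ, so division by the number of terms makes the defect small.
  have hS3 : ∀ m, krausMap V (S m) + N 0 ≤ S m + N m := by
    intro m
    induction m with
    | zero => simp [S, krausMap_zero hVS]
    | succ m ih =>
      rw [hSs, krausMap_add hVS]
      calc krausMap V (S m) + krausMap V (N m) + N 0
          = (krausMap V (S m) + N 0) + krausMap V (N m) := by abel
        _ ≤ _ := add_le_add ih (h3 m)
  have hc : ∀ m : ℕ, (0 : ℝ) ≤ 1 / ((m : ℝ) + 1) := fun m => by positivity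
  have hcm : ∀ m : ℕ, ((1 / ((m : ℝ) + 1) : ℝ) : ℂ) * (((m + 1 : ℕ) : ℝ) : ℂ) = 1 := by
    intro m
    rw [← Complex.ofReal_mul, ← Complex.ofReal_one]
    congr 1
    push_cast
    field_simp
  refine ⟨fun m => ((1 / ((m : ℝ) + 1) : ℝ) : ℂ) • S (m + 1), fun m => ?_, fun m => ?_,
    fun m => ?_, fun m => ?_⟩
  · simpa using ofReal_smul_le_smul (hS0 (m + 1)) (hc m)
  · refine (ofReal_smul_le_smul (hS1 (m + 1)) (hc m)).trans_eq ?_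
    rw [smul_smul, hcm, one_smul]
  · rw [compression_smul, hS2, smul_smul, hcm, one_smul]
  · rw [krausMap_smul hVS, ← smul_add]
    refine ofReal_smul_le_smul ?_ (hc m)
    calc krausMap V (S (m + 1)) ≤ krausMap V (S (m + 1)) + N 0 := le_add_of_nonneg_right (h0 0)
      _ ≤ S (m + 1) + N (m + 1) := hS3 _
      _ ≤ _ := by
        gcongr
        exact h1 _

/-- A positive solution of `φ_T(X) ≤ X` lifts, with the same norm, to a positive solution of
`φ_V(X) ≤ X`. -/
lemma IsMinimalIsometricDilation.exists_lift (hT : KrausSummable T)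
    (hV : IsMinimalIsometricDilation T J V) {A : H →L[ℂ] H} (hA : 0 ≤ A)
    (hTA : krausMap T A ≤ A) :
    ∃ M : K →L[ℂ] K, 0 ≤ M ∧ krausMap V M ≤ M ∧ compression J M = A ∧ ‖M‖ = ‖A‖ := by
  have hVS := hV.isOrthogonalIsometries.krausSummable
  obtain ⟨E, h0, h1, h2, h3⟩ := hV.exists_almost_lift hT hA hTA
  set a : K →L[ℂ] K := (‖A‖ : ℂ) • 1
  have hna : ‖a‖ ≤ ‖A‖ := by
    refine (norm_smul_le _ _).trans ?_
    rw [Complex.norm_real, norm_norm]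
    exact mul_le_of_le_one_right (norm_nonneg _) norm_id_le
  obtain ⟨M, hM⟩ := exists_weak_limit (hyperfilter ℕ) (X := E) (C := ‖A‖) fun m =>
    (CStarAlgebra.norm_le_norm_of_nonneg_of_le (h0 m) (h1 m)).trans hna
  have hM0 : 0 ≤ M := by
    rw [nonneg_iff_inner]
    exact fun x => ge_of_tendsto' (hM x x) fun m => (nonneg_iff_inner _).1 (h0 m) x
  have hM1 : M ≤ a := by
    rw [le_iff_inner]
    exact fun x => le_of_tendsto' (hM x x) fun m => (le_iff_inner _ _).1 (h1 m) x
  have hM2 : compression J M = A := by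
    refine ext_inner_self fun x => ?_
    have h4 : ∀ Y : K →L[ℂ] K, ⟪x, compression J Y x⟫_ℂ = ⟪J x, Y (J x)⟫_ℂ := by
      intro Y
      simp only [compression, comp_apply, adjoint_inner_right]
      rfl
    rw [h4]
    refine tendsto_nhds_unique (hM _ _) (tendsto_const_nhds.congr fun m => ?_)
    rw [← h4, h2]
  refine ⟨M, hM0, ?_, hM2, le_antisymm ?_ ?_⟩
  · rw [le_iff_inner]
    intro x
    -- The terms for `E m` are nonnegative, so their finite partial sums are dominated by the full
    -- series. The weak limit is taken in finite sums only, with no exchange of limit and series.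
    refine hasSum_le_of_sum_le (hasSum_krausMap hVS M x x) fun F => ?_
    have h5 : Tendsto (fun m => ∑ i ∈ F, ⟪adjoint (V i) x, E m (adjoint (V i) x)⟫_ℂ)
        (hyperfilter ℕ : Filter ℕ)
        (𝓝 (∑ i ∈ F, ⟪adjoint (V i) x, M (adjoint (V i) x)⟫_ℂ)) :=
      tendsto_finsetSum F fun i _ => hM _ _
    have h6 : Tendsto (fun m : ℕ => ⟪x, E m x⟫_ℂ + ((1 / ((m : ℝ) + 1) : ℝ) : ℂ) * ⟪x, a x⟫_ℂ)
        (hyperfilter ℕ : Filter ℕ) (𝓝 (⟪x, M x⟫_ℂ + ((0 : ℝ) : ℂ) * ⟪x, a x⟫_ℂ)) := by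
      refine (hM x x).add (Tendsto.mul_const _ ?_)
      exact ((Complex.continuous_ofReal.tendsto 0).comp
        tendsto_one_div_add_atTop_nhds_zero_nat).mono_left Nat.hyperfilter_le_atTop
    rw [Complex.ofReal_zero, zero_mul, add_zero] at h6
    refine le_of_tendsto_of_tendsto' h5 h6 fun m => ?_
    have h7 := (le_iff_inner _ _).1 (h3 m) x
    rw [add_apply, inner_add_right, smul_apply, inner_smul_right] at h7
    refine le_trans ?_ h7
    exact sum_le_hasSum F (fun i _ => (nonneg_iff_inner _).1 (h0 m) _)
      (hasSum_krausMap hVS (E m) x x)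
  · exact (CStarAlgebra.norm_le_norm_of_nonneg_of_le hM0 hM1).trans hna
  · rw [← hM2]
    exact norm_compression_le J M

end Lifting

/-! ### The Poisson kernel of a pure solution. -/

section Poisson

open scoped ComplexOrder InnerProductSpace

variable {ι : Type*} {K : Type*} [NormedAddCommGroup K] [InnerProductSpace ℂ K] [CompleteSpace K]
  {V : ι → K →L[ℂ] K}

/-- A nonempty word splits uniquely into its first letter and the rest; in `ENNReal` no summability
is needed. -/
lemma tsum_freeMonoid (f : FreeMonoid ι → ENNReal) :
    ∑' α, f α = f 1 + ∑' i, ∑' α, f (FreeMonoid.of i * α) := by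
  classical
  rw [ENNReal.tsum_eq_add_tsum_ite 1]
  congr 1
  have hinj : Function.Injective fun p : ι × FreeMonoid ι => FreeMonoid.of p.1 * p.2 := by
    rintro ⟨i, α⟩ ⟨j, β⟩ h
    obtain ⟨h1, h2⟩ := List.cons.inj h
    exact Prod.ext h1 h2
  rw [← hinj.tsum_eq, ENNReal.tsum_prod']
  · refine tsum_congr fun i => tsum_congr fun α => if_neg ?_
    exact List.cons_ne_nil _ _
  · intro α hα
    induction α using FreeMonoid.casesOn with
    | one => simp at hα
    | of_mul i α => exact ⟨(i, α), rfl⟩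

lemma adjoint_lift_of_mul_apply (V : ι → K →L[ℂ] K) (i : ι) (α : FreeMonoid ι) (h : K) :
    adjoint (FreeMonoid.lift V (FreeMonoid.of i * α)) h =
      adjoint (FreeMonoid.lift V α) (adjoint (V i) h) := by
  rw [map_mul, FreeMonoid.lift_eval_of, ← star_eq_adjoint, star_mul]
  rfl

variable {C : K →L[ℂ] K}

/-- Words of length `j` contribute the quadratic form of `φʲ(C - φ(C))`, and these telescope. The
induction peels off the first letter through `C - φᵏ⁺¹(C) = (C - φ(C)) + φ(C - φᵏ(C))`. -/
lemma tsum_norm_sq_length_lt (hV : KrausSummable V) (hC : krausMap V C ≤ C) (k : ℕ) (h : K) :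
    ∑' α : FreeMonoid ι, (if α.length < k then
      ENNReal.ofReal (‖CFC.sqrt (C - krausMap V C) (adjoint (FreeMonoid.lift V α) h)‖ ^ 2) else 0) =
      ENNReal.ofReal (⟪h, (C - (krausMap V)^[k] C) h⟫_ℂ).re := by
  induction k generalizing h with
  | zero => simp
  | succ k ih =>
    have hanti := antitone_krausMap_iterate hV hC
    have hk : 0 ≤ C - (krausMap V)^[k] C := sub_nonneg.2 (hanti (Nat.zero_le k))
    rw [tsum_freeMonoid]
    simp only [FreeMonoid.length_mul, FreeMonoid.length_of,
      Nat.add_comm 1, Nat.add_lt_add_iff_right, adjoint_lift_of_mul_apply, ih]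
    have h1 : HasSum (fun i => (⟪adjoint (V i) h,
        (C - (krausMap V)^[k] C) (adjoint (V i) h)⟫_ℂ).re)
        (⟪h, krausMap V (C - (krausMap V)^[k] C) h⟫_ℂ).re :=
      Complex.hasSum_re (hasSum_krausMap hV _ h h)
    have h2 : ∀ x, 0 ≤ (⟪x, (C - (krausMap V)^[k] C) x⟫_ℂ).re := fun x =>
      (Complex.le_def.1 ((nonneg_iff_inner _).1 hk x)).1
    rw [← ENNReal.ofReal_tsum_of_nonneg (fun i => h2 _) h1.summable, h1.tsum_eq,
      if_pos (show FreeMonoid.length 1 < k + 1 by simp), ← ENNReal.ofReal_add (sq_nonneg _) (h1.nonneg fun i => h2 _)]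
    congr 1
    have h3 := norm_sq_sqrt_apply (sub_nonneg.2 hC) h
    rw [map_one, ← star_eq_adjoint, star_one, one_apply_eq_self, ← Complex.ofReal_re (_ ^ 2), h3,
      ← Complex.add_re, ← inner_add_right, ← add_apply, krausMap_sub hV,
      ← Function.iterate_succ_apply' (krausMap V) k C]
    congr 3
    abel

/-- As `k → ∞` in the telescoped identity, purity removes the term `φᵏ(C)`. -/
lemma hasSum_norm_sq_adjoint_lift (hV : KrausSummable V) (h0 : 0 ≤ C)
    (hC : IsPureSolution (krausMap V) C) (h : K) :
    HasSum (fun α : FreeMonoid ι =>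
      ‖CFC.sqrt (C - krausMap V C) (adjoint (FreeMonoid.lift V α) h)‖ ^ 2) (⟪h, C h⟫_ℂ).re := by
  set g : FreeMonoid ι → ℝ := fun α =>
    ‖CFC.sqrt (C - krausMap V C) (adjoint (FreeMonoid.lift V α) h)‖ ^ 2
  have hg : ∀ α, 0 ≤ g α := fun α => sq_nonneg _
  have hCh : 0 ≤ (⟪h, C h⟫_ℂ).re := (Complex.le_def.1 ((nonneg_iff_inner _).1 h0 h)).1
  have hle : ∀ k, (⟪h, (C - (krausMap V)^[k] C) h⟫_ℂ).re ≤ (⟪h, C h⟫_ℂ).re := fun k =>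
    (Complex.le_def.1 ((le_iff_inner _ _).1
      (sub_le_self _ (krausMap_iterate_nonneg hV h0 k)) h)).1
  have htot : ∑' α, ENNReal.ofReal (g α) = ENNReal.ofReal (⟪h, C h⟫_ℂ).re := by
    apply le_antisymm
    · rw [ENNReal.tsum_eq_iSup_sum]
      refine iSup_le fun F => ?_
      obtain ⟨k, hk⟩ : ∃ k, ∀ α ∈ F, α.length < k :=
        ⟨F.sup FreeMonoid.length + 1, fun α hα => Nat.lt_succ_of_le (Finset.le_sup hα)⟩
      calc ∑ α ∈ F, ENNReal.ofReal (g α)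
          = ∑ α ∈ F, if α.length < k then ENNReal.ofReal (g α) else 0 :=
            Finset.sum_congr rfl fun α hα => (if_pos (hk α hα)).symm
        _ ≤ _ := ENNReal.sum_le_tsum F
        _ = _ := tsum_norm_sq_length_lt hV hC.1 k h
        _ ≤ _ := ENNReal.ofReal_le_ofReal (hle k)
    · have hlim : Tendsto (fun k => ENNReal.ofReal (⟪h, (C - (krausMap V)^[k] C) h⟫_ℂ).re) atTop
          (𝓝 (ENNReal.ofReal (⟪h, C h⟫_ℂ).re)) := by
        refine ENNReal.tendsto_ofReal ((Complex.continuous_re.tendsto _).comp ?_)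
        have : Tendsto (fun k => C h - (krausMap V)^[k] C h) atTop (𝓝 (C h - 0)) :=
          tendsto_const_nhds.sub (hC.2 h)
        rw [sub_zero] at this
        exact tendsto_const_nhds.inner this
      refine le_of_tendsto' hlim fun k => ?_
      rw [← tsum_norm_sq_length_lt hV hC.1 k h]
      refine ENNReal.tsum_le_tsum fun α => ?_
      split_ifs
      · exact le_rfl
      · exact zero_le
  have hsum : Summable g := by
    have := ENNReal.summable_toReal (f := fun α => ENNReal.ofReal (g α))
      (htot ▸ ENNReal.ofReal_ne_top)
    simpa only [ENNReal.toReal_ofReal (hg _)] using this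
  rw [← ENNReal.ofReal_tsum_of_nonneg hg hsum,
    ENNReal.ofReal_eq_ofReal_iff (tsum_nonneg hg) hCh] at htot
  exact htot ▸ hsum.hasSum

/-- A positive pure solution `C` of `φ_V(X) ≤ X` is of the form `Q* Q` with
`Vᵢ Q* = Q* (Sᵢ ⊗ I)`. -/
lemma exists_intertwining_factorization [Countable ι] (hV : KrausSummable V) (h0 : 0 ≤ C)
    (hC : IsPureSolution (krausMap V) C) :
    ∃ Q : K →L[ℂ] Fock ι K,
      (∀ i, V i ∘L adjoint Q = adjoint Q ∘L (creation K i).toContinuousLinearMap) ∧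
      C = adjoint Q ∘L Q := by
  set Δ := CFC.sqrt (C - krausMap V C)
  have hsum := hasSum_norm_sq_adjoint_lift hV h0 hC
  let Q₀ : K →ₗ[ℂ] Fock ι K :=
    { toFun h := ⟨fun α => Δ (adjoint (FreeMonoid.lift V α) h),
        memℓp_gen (by simpa using (hsum h).summable)⟩
      map_add' x y := by
        ext α
        exact (congrArg Δ (map_add _ _ _)).trans (map_add _ _ _)
      map_smul' c x := by
        ext α
        exact (congrArg Δ (map_smul _ _ _)).trans (map_smul _ _ _) }
  have hQ₀ : ∀ h, ‖Q₀ h‖ ^ 2 = (⟪h, C h⟫_ℂ).re := by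
    intro h
    have h1 := lp.norm_rpow_eq_tsum (p := 2) (by norm_num) (Q₀ h)
    have h2 : ‖Q₀ h‖ ^ 2 = ∑' α, ‖Q₀ h α‖ ^ 2 := by simpa using h1
    rw [h2]
    exact (hsum h).tsum_eq
  -- `‖C‖ + 1` serves as a bound since `‖C‖ ≤ (‖C‖ + 1)²`, which avoids a square root.
  let Q : K →L[ℂ] Fock ι K := Q₀.mkContinuous (‖C‖ + 1) fun h => by
    refine (sq_le_sq₀ (norm_nonneg _) (by positivity)).1 ?_
    rw [hQ₀]
    calc (⟪h, C h⟫_ℂ).re ≤ ‖h‖ * ‖C h‖ := re_inner_le_norm (𝕜 := ℂ) h (C h)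
      _ ≤ ‖h‖ * (‖C‖ * ‖h‖) := by
        gcongr
        exact le_opNorm _ _
      _ ≤ _ := by nlinarith [norm_nonneg C, sq_nonneg ‖h‖, sq_nonneg (‖C‖ * ‖h‖),
          mul_nonneg (norm_nonneg C) (sq_nonneg ‖h‖)]
  refine ⟨Q, fun i => ?_, ?_⟩
  · have h1 : Q ∘L adjoint (V i) = adjoint (creation K i).toContinuousLinearMap ∘L Q := by
      ext h α
      refine Eq.trans ?_ (adjoint_creation_apply i (Q h) α).symm
      exact congrArg Δ (adjoint_lift_of_mul_apply V i α h).symm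
    have h2 := congrArg adjoint h1
    simpa only [adjoint_comp, adjoint_adjoint] using h2
  · refine ext_inner_self fun x => ?_
    rw [comp_apply, adjoint_inner_right, inner_self_eq_ofReal]
    have h3 : ‖Q x‖ ^ 2 = (⟪x, C x⟫_ℂ).re := hQ₀ x
    rw [h3]
    exact Complex.eq_re_of_ofReal_le ((nonneg_iff_inner _).1 h0 x)

end Poisson

/-! ### Existence of a representation. -/

section Existence

open scoped ComplexOrder InnerProductSpace

variable {ι : Type*} [Countable ι]
  {H : Type*} [NormedAddCommGroup H] [InnerProductSpace ℂ H] [CompleteSpace H]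
  {K : Type*} [NormedAddCommGroup K] [InnerProductSpace ℂ K] [CompleteSpace K]
  {T : ι → H →L[ℂ] H} {V : ι → K →L[ℂ] K} {J : H →ₗᵢ[ℂ] K}

/-- Every positive solution of `φ_T(X) ≤ X` has a representation with multiplicity space `K`. -/
lemma IsMinimalIsometricDilation.exists_represents (hT : KrausSummable T)
    (hV : IsMinimalIsometricDilation T J V) {A : H →L[ℂ] H} (hA : 0 ≤ A)
    (hTA : krausMap T A ≤ A) :
    ∃ (B : K →L[ℂ] K) (Q : K →L[ℂ] Fock ι K) (A₁ A₂ : K →L[ℂ] K),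
      Represents J V A B Q A₁ A₂ := by
  have hO := hV.isOrthogonalIsometries
  have hVS := hO.krausSummable
  obtain ⟨M, hM0, hM1, hM2, hM3⟩ := hV.exists_lift hT hA hTA
  have hanti := antitone_krausMap_iterate hVS hM1
  obtain ⟨B, hB⟩ := exists_isSOTLimit_of_antitone hanti (krausMap_iterate_nonneg hVS hM0)
  have hB0 : 0 ≤ B := nonneg_of_isSOTLimit hB (krausMap_iterate_nonneg hVS hM0)
  have hfix : krausMap V B = B := krausMap_eq_self_of_isSOTLimit hVS hB
  have hC0 : 0 ≤ M - B :=
    nonneg_of_isSOTLimit (X := fun k => M - (krausMap V)^[k] M)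
      (fun h => tendsto_const_nhds.sub (hB h)) fun k => sub_nonneg.2 (hanti (Nat.zero_le k))
  have hpure : IsPureSolution (krausMap V) (M - B) := by
    constructor
    · rw [krausMap_sub hVS, hfix]
      exact sub_le_sub_right hM1 B
    · intro h
      simp only [krausMap_iterate_sub hVS, Function.iterate_fixed hfix, sub_apply, zero_apply]
      simpa using (hB h).sub_const (B h)
  obtain ⟨Q, hQ, hCQ⟩ := exists_intertwining_factorization hVS hC0 hpure
  -- `B` is already fixed by `φ_V`, so it is both the commutant element and its own limit `A₁`.
  refine ⟨B, Q, B, M - B, hO.inCommutant_of_fixed hB0.isSelfAdjoint hfix, fun h => ?_, hQ, hCQ,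
    ?_, ?_⟩
  · simp only [Function.iterate_fixed hfix]
    exact tendsto_const_nhds
  · rw [← compression_add, add_sub_cancel, hM2]
  · rw [add_sub_cancel, hM3]

end Existence

end CPMap
end

theorem theorem3p8
    {ι : Type u} [Countable ι] [Nonempty ι]
    {H : Type v} [NormedAddCommGroup H] [InnerProductSpace ℂ H] [CompleteSpace H]
    [TopologicalSpace.SeparableSpace H]
    {𝒦 : Type w} [NormedAddCommGroup 𝒦] [InnerProductSpace ℂ 𝒦] [CompleteSpace 𝒦]
    (T : ι → H →L[ℂ] H) (hT : CPMap.KrausSummable T) (hT1 : CPMap.krausMap T 1 ≤ 1)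
    (J : H →ₗᵢ[ℂ] 𝒦) (V : ι → 𝒦 →L[ℂ] 𝒦) (hV : CPMap.IsMinimalIsometricDilation T J V) :
    -- the limit that defines `A₁` exists for every `B` in the commutant
    (∀ B : 𝒦 →L[ℂ] 𝒦, CPMap.InCommutant V B →
      ∃ A₁ : 𝒦 →L[ℂ] 𝒦, CPMap.IsSOTLimit (fun k => (CPMap.krausMap V)^[k] B) A₁) ∧
    ∀ A : H →L[ℂ] H, 0 ≤ A →
      -- characterization of the solutions
      (CPMap.krausMap T A ≤ A ↔
        ∃ (B : 𝒦 →L[ℂ] 𝒦)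
          (D : Type w) (_ : NormedAddCommGroup D) (_ : InnerProductSpace ℂ D)
          (_ : CompleteSpace D) (Q : 𝒦 →L[ℂ] CPMap.Fock ι D) (A₁ A₂ : 𝒦 →L[ℂ] 𝒦),
          CPMap.Represents J V A B Q A₁ A₂) ∧
      -- every such representation gives the (unique) canonical decomposition
      (∀ (B : 𝒦 →L[ℂ] 𝒦)
          (D : Type x) [NormedAddCommGroup D] [InnerProductSpace ℂ D]
          [CompleteSpace D] (Q : 𝒦 →L[ℂ] CPMap.Fock ι D) (A₁ A₂ : 𝒦 →L[ℂ] 𝒦),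
          CPMap.Represents J V A B Q A₁ A₂ →
          ∀ A' A'' : H →L[ℂ] H,
            CPMap.IsCanonicalDecomposition (CPMap.krausMap T) A A' A'' ↔
              A' = CPMap.compression J A₁ ∧ A'' = CPMap.compression J A₂) := by
  refine ⟨fun B hB => hV.isOrthogonalIsometries.exists_isSOTLimit_iterate hB,
    fun A hA => ⟨⟨fun hTA => ?_, ?_⟩, ?_⟩⟩
  · obtain ⟨B, Q, A₁, A₂, h⟩ := hV.exists_represents hT hA hTA
    exact ⟨B, 𝒦, inferInstance, inferInstance, inferInstance, Q, A₁, A₂, h⟩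
  · rintro ⟨B, D, _, _, _, Q, A₁, A₂, h⟩
    have hc := h.isCanonicalDecomposition hT hV hA
    rw [hc.sum_eq, CPMap.krausMap_add hT, hc.fixed]
    exact add_le_add le_rfl hc.pure.1
  · intro B D _ _ _ Q A₁ A₂ h A' A''
    have hc := h.isCanonicalDecomposition hT hV hA
    constructor
    · intro hd
      have h1 : A' = CPMap.compression J A₁ := (hd.isSOTLimit hT).unique (hc.isSOTLimit hT)
      have h2 := hd.sum_eq.symm.trans hc.sum_eq
      rw [h1, add_right_inj] at h2
      exact ⟨h1, h2⟩
    · rintro ⟨rfl, rfl⟩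
      exact hc
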